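/- Let $N\ge 3$ and $a_1,\dots,a_N>0$. For $t\ge 0$ put $$A_t=\mathrm{diag}\Big(\frac1{a_1^2+t},\dots,\frac1{a_N^2+t}\Big),\qquad \gamma_t=\prod_{i=1}^N\frac{a_i}{\sqrt{a_i^2+t}},\qquad \Omega_t=\Big\{x\in\mathbb{R}^N:\ \sum_{i=1}^N\frac{x_i^2}{a_i^2+t}\le 1\Big\},$$ and let $\Omega=\Omega_0$ be the ellipsoid with semi-axes $a_1,\dots,a_N$. Let $\omega_N$ be the surface measure of the unit sphere in $\mathbb{R}^N$ and let $$\mathcal N_\Omega[1_\Omega](x)=\frac{1}{(N-2)\,\omega_N}\int_\Omega\frac{dy}{|x-y|^{N-2}}$$ be the Newtonian potential of $\Omega$. Then there is exactly one function $\tau:\mathbb{R}^N\to[0,\infty)$ such that $\tau(x)=0$ for $x\in\overline\Omega$ and $x\in\partial\Omega_{\tau(x)}$ for $x\notin\Omega$. For every $x\in\mathbb{R}^N$ the two integrals in the following formula converge absolutely, and $$\mathcal N_\Omega[1_\Omega](x)=\frac14\int_{\tau(x)}^{\infty}\gamma_t\,\bigl(1-A_tx\cdot x\bigr)\,dt .$$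 In particular, the potential is a quadratic polynomial on the closed ellipsoid: for every $x\in\overline\Omega$, $$\mathcal N_\Omega[1_\Omega](x)=\frac14\int_0^\infty\gamma_t\,dt-\sum_{i=1}^N\Big(\frac14\int_0^\infty\frac{\gamma_t}{a_i^2+t}\,dt\Big)x_i^2 .$$ -/

import Mathlib

open MeasureTheory Set

namespace EllipsoidPotential

noncomputable section

/-- Surface measure `ω_N` of the unit sphere of `ℝ^N`. -/
def sphereArea (N : ℕ) : ℝ :=
  (volume : Measure (EuclideanSpace ℝ (Fin N))).toSphere.real univ

/-- Newtonian potential of the density `ρ` on `Ω ⊆ ℝ^N`, namely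
`((N - 2) ω_N)⁻¹ ∫_Ω ρ(y) / |x - y|^(N - 2) dy`, for `N ≥ 3`. -/
def newtonianPotential {N : ℕ} (Ω : Set (EuclideanSpace ℝ (Fin N)))
    (ρ : EuclideanSpace ℝ (Fin N) → ℝ) (x : EuclideanSpace ℝ (Fin N)) : ℝ :=
  (((N : ℝ) - 2) * sphereArea N)⁻¹ * ∫ y in Ω, ρ y / ‖x - y‖ ^ (N - 2)

/-- The matrix `A_t = diag(1 / (a_i² + t))`. -/
def matA {N : ℕ} (a : Fin N → ℝ) (t : ℝ) : Matrix (Fin N) (Fin N) ℝ :=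
  Matrix.diagonal fun i => 1 / (a i ^ 2 + t)

/-- The matrix `√A_t = diag(1 / √(a_i² + t))`. -/
def sqrtMatA {N : ℕ} (a : Fin N → ℝ) (t : ℝ) : Matrix (Fin N) (Fin N) ℝ :=
  Matrix.diagonal fun i => 1 / √(a i ^ 2 + t)

/-- The map `φ_t(x) = √A_t x`. -/
def phi {N : ℕ} (a : Fin N → ℝ) (t : ℝ) (x : EuclideanSpace ℝ (Fin N)) :
    EuclideanSpace ℝ (Fin N) :=
  Matrix.toEuclideanLin (sqrtMatA a t) x

/-- The confocal solid ellipsoid `Ω_t = {x | |φ_t(x)|² ≤ 1}`; `Ω = Ω_0` has the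
semi-axes `a_i`. -/
def ellipsoid {N : ℕ} (a : Fin N → ℝ) (t : ℝ) : Set (EuclideanSpace ℝ (Fin N)) :=
  {x | ‖phi a t x‖ ^ 2 ≤ 1}

/-- The weight `γ_t = ∏ a_i / √(a_i² + t)`. -/
def gammaWeight {N : ℕ} (a : Fin N → ℝ) (t : ℝ) : ℝ :=
  ∏ i, a i / √(a i ^ 2 + t)

/-- `τ : ℝ^N → [0, ∞)` vanishes on the closed ellipsoid, and every `x` outside the
ellipsoid lies on the boundary of the confocal ellipsoid with parameter `τ x`. -/
def IsConfocalParameter {N : ℕ} (a : Fin N → ℝ) (τ : EuclideanSpace ℝ (Fin N) → ℝ) : Prop :=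
  (∀ x, 0 ≤ τ x) ∧
  (∀ x ∈ closure (ellipsoid a 0), τ x = 0) ∧
  (∀ x ∈ (ellipsoid a 0)ᶜ, x ∈ frontier (ellipsoid a (τ x)))

/-- The integrand `γ_t (1 - A_t x · x)`. -/
def potentialIntegrand {N : ℕ} (a : Fin N → ℝ) (x : EuclideanSpace ℝ (Fin N)) (t : ℝ) : ℝ :=
  gammaWeight a t * (1 - inner ℝ (Matrix.toEuclideanLin (matA a t) x) x)

end

end EllipsoidPotential

/-! Write `q_t(x) = A_t x · x`. Fix `x` and compare two nonnegative functions: `q_0(y)` under the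
measure `Γ(N/2-1) |x-y|^(2-N) dy`, and `q_t(x) + s` under `π^(N/2) γ_t dt ds` on the quadrant `t, s
> 0`. Their distributions coincide, and the measures of the sublevel sets at level 1 give the
formula: on one side the unnormalized potential of the ellipsoid, on the other `π^(N/2) ∫ γ_t (1 -
q_t(x))₊ dt`, where the positive part cuts the integral at `τ(x)`.

The distributions are compared through Laplace transforms (`measure_le_eq_of_lintegral_exp_neg_eq`).
Writing the kernel as a Gamma integral of Gaussians `exp(-u|x-y|²)` turns the transform of the first
into a convolution of Gaussians; the substitution `t = l/u` then produces `γ_t exp(-l q_t(x))`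
(`lintegral_riesz_mul_exp_neg_quadForm`). The second transform is immediate, the `s`-integral
supplying `1/l`. No differential equation or boundary condition enters. -/

namespace EllipsoidPotential

open scoped NNReal ENNReal BoundedContinuousFunction

/-! ### Uniqueness for Laplace transforms sampled at integers. -/

/-- The bounded continuous function `v ↦ exp (-v)` on `[0, ∞)`. -/
noncomputable def expNegBCF : ℝ≥0 →ᵇ ℝ :=
  BoundedContinuousFunction.ofNormedAddCommGroup (fun v : ℝ≥0 => Real.exp (-v)) (by fun_prop) 1
    (fun v => by simp [abs_of_pos (Real.exp_pos _)])

@[simp] lemma expNegBCF_apply (v : ℝ≥0) : expNegBCF v = Real.exp (-v) := rfl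

lemma expNegBCF_pow_apply (n : ℕ) (v : ℝ≥0) : (expNegBCF ^ n) v = Real.exp (-(n * v)) := by
  rw [BoundedContinuousFunction.pow_apply, expNegBCF_apply, ← Real.exp_nat_mul]
  congr 1; ring

/-- Polynomials in `exp(-v)` form a subalgebra of bounded continuous functions that separates
points, which is enough to determine a finite measure. -/
theorem ext_of_integral_exp_neg_nat {μ ν : Measure ℝ≥0} [IsFiniteMeasure μ]
    [IsFiniteMeasure ν]
    (h : ∀ n : ℕ, ∫ v, Real.exp (-(n * v)) ∂μ = ∫ v, Real.exp (-(n * v)) ∂ν) : μ = ν := by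
  have key (p : Polynomial ℝ) : ∫ v, Polynomial.aeval expNegBCF p v ∂μ =
      ∫ v, Polynomial.aeval expNegBCF p v ∂ν := by
    induction p using Polynomial.induction_on' with
    | add p q hp hq =>
      simp only [map_add, BoundedContinuousFunction.coe_add, Pi.add_apply]
      rw [integral_add (BoundedContinuousFunction.integrable _ _)
        (BoundedContinuousFunction.integrable _ _),
        integral_add (BoundedContinuousFunction.integrable _ _)
        (BoundedContinuousFunction.integrable _ _), hp, hq]
    | monomial n c =>
      have hc (v : ℝ≥0) : algebraMap ℝ (ℝ≥0 →ᵇ ℝ) c v = c := by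
        simp [Algebra.algebraMap_eq_smul_one]
      simp only [Polynomial.aeval_monomial, BoundedContinuousFunction.coe_mul, Pi.mul_apply,
        expNegBCF_pow_apply, hc, integral_const_mul, h]
  let A : StarSubalgebra ℝ (ℝ≥0 →ᵇ ℝ) :=
    { Algebra.adjoin ℝ {expNegBCF} with
      star_mem' := by
        intro a ha
        have : star a = a := by ext v; simp
        rwa [this] }
  refine ext_of_forall_mem_subalgebra_integral_eq_of_pseudoEMetric_complete_countable
    (A := A) ?_ ?_
  · intro v w hvw
    refine ⟨expNegBCF, ⟨expNegBCF.toContinuousMap, ⟨expNegBCF, ?_, rfl⟩, rfl⟩, ?_⟩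
    · exact Algebra.subset_adjoin rfl
    · simpa using hvw
  · intro g hg
    have hg' : g ∈ Algebra.adjoin ℝ {expNegBCF} := hg
    rw [Algebra.adjoin_singleton_eq_range_aeval] at hg'
    obtain ⟨p, rfl⟩ := hg'
    exact key p

/-- Two nonnegative functions on measure spaces have the same distribution when their Laplace
transforms agree at the positive integers and are finite at `1`. -/
theorem measure_le_eq_of_lintegral_exp_neg_eq {α β : Type*} [MeasurableSpace α] [MeasurableSpace β]
    {μ : Measure α} {ν : Measure β} {f : α → ℝ} {g : β → ℝ} (hf : Measurable f) (hg : Measurable g)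
    (hf0 : ∀ᵐ x ∂μ, 0 ≤ f x) (hg0 : ∀ᵐ x ∂ν, 0 ≤ g x)
    (h : ∀ n : ℕ, ∫⁻ x, ENNReal.ofReal (Real.exp (-((n + 1) * f x))) ∂μ =
      ∫⁻ x, ENNReal.ofReal (Real.exp (-((n + 1) * g x))) ∂ν)
    (hfin : ∫⁻ x, ENNReal.ofReal (Real.exp (-f x)) ∂μ ≠ ∞) {c : ℝ} (hc : 0 ≤ c) :
    μ {x | f x ≤ c} = ν {x | g x ≤ c} := by
  -- The pushforwards may be infinite; the weight `exp(-v)` makes them finite and shifts the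
  -- exponents `n + 1` to `n`, so that the constant function is covered.
  set w : ℝ≥0 → ℝ≥0∞ := fun v => ENNReal.ofReal (Real.exp (-v)) with hw
  have hwm : Measurable w := by fun_prop
  set μ' := (μ.map fun x => (f x).toNNReal) with hμ'
  set ν' := (ν.map fun x => (g x).toNNReal) with hν'
  have hμl : ∀ n : ℕ, ∫⁻ v : ℝ≥0, ENNReal.ofReal (Real.exp (-((n + 1) * v))) ∂μ' =
      ∫⁻ x, ENNReal.ofReal (Real.exp (-((n + 1) * f x))) ∂μ := fun n => by
    rw [hμ', lintegral_map (by fun_prop) (by fun_prop)]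
    refine lintegral_congr_ae ?_
    filter_upwards [hf0] with x hx
    simp only [Real.coe_toNNReal _ hx]
  have hνl : ∀ n : ℕ, ∫⁻ v : ℝ≥0, ENNReal.ofReal (Real.exp (-((n + 1) * v))) ∂ν' =
      ∫⁻ x, ENNReal.ofReal (Real.exp (-((n + 1) * g x))) ∂ν := fun n => by
    rw [hν', lintegral_map (by fun_prop) (by fun_prop)]
    refine lintegral_congr_ae ?_
    filter_upwards [hg0] with x hx
    simp only [Real.coe_toNNReal _ hx]
  have hexp : ∀ (n : ℕ) (v : ℝ≥0), w v * ENNReal.ofReal (Real.exp (-(n * v))) =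
      ENNReal.ofReal (Real.exp (-((n + 1) * v))) := fun n v => by
    rw [hw, ← ENNReal.ofReal_mul (Real.exp_pos _).le, ← Real.exp_add]
    congr 2; ring
  have hint : ∀ (ρ : Measure ℝ≥0) (n : ℕ), ∫ v, Real.exp (-(n * v)) ∂(ρ.withDensity w) =
      (∫⁻ v : ℝ≥0, ENNReal.ofReal (Real.exp (-((n + 1) * v))) ∂ρ).toReal := fun ρ n => by
    rw [integral_eq_lintegral_of_nonneg_ae (.of_forall fun v => (Real.exp_pos _).le)
      (by fun_prop), lintegral_withDensity_eq_lintegral_mul _ hwm (by fun_prop)]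
    simp only [Pi.mul_apply, hexp]
  have h1 := h 0
  have hμ1 := hμl 0
  have hν1 := hνl 0
  simp only [Nat.cast_zero, zero_add, one_mul] at h1 hμ1 hν1
  have fμ : IsFiniteMeasure (μ'.withDensity w) := isFiniteMeasure_withDensity (by
    rw [hw, hμ1]; exact hfin)
  have fν : IsFiniteMeasure (ν'.withDensity w) := isFiniteMeasure_withDensity (by
    rw [hw, hν1, ← h1]; exact hfin)
  have key : μ'.withDensity w = ν'.withDensity w :=
    ext_of_integral_exp_neg_nat fun n => by rw [hint, hint, hμl, hνl, h]
  have key2 : μ' = ν' := by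
    -- The weight is positive and finite, so it can be divided out again.
    have inv : ∀ ρ : Measure ℝ≥0, (ρ.withDensity w).withDensity w⁻¹ = ρ := fun ρ =>
      withDensity_inv_same hwm (.of_forall fun v => by simp [hw, Real.exp_pos])
        (.of_forall fun v => ENNReal.ofReal_ne_top)
    rw [← inv μ', key, inv]
  have hs : ∀ r : ℝ, r.toNNReal ∈ Iic c.toNNReal ↔ r ≤ c := fun r => by
    rw [mem_Iic, Real.toNNReal_le_toNNReal_iff hc]
  have := congrArg (fun ρ => ρ (Iic c.toNNReal)) key2
  simp only [hμ', hν'] at this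
  rw [Measure.map_apply (by fun_prop) measurableSet_Iic,
    Measure.map_apply (by fun_prop) measurableSet_Iic] at this
  simpa only [preimage, hs] using this

/-! ### Gaussian and Gamma integrals. -/

theorem integral_gaussian_convolution {u c : ℝ} (hu : 0 < u) (hc : 0 < c) (x : ℝ) :
    ∫ y : ℝ, Real.exp (-(u * (x - y) ^ 2 + c * y ^ 2)) =
      √(Real.pi / (u + c)) * Real.exp (-(u * c / (u + c) * x ^ 2)) := by
  have huc : u + c ≠ 0 := by positivity
  -- Complete the square in `y`.
  have : ∀ y : ℝ, Real.exp (-(u * (x - y) ^ 2 + c * y ^ 2)) =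
      Real.exp (-(u + c) * (y - u * x / (u + c)) ^ 2) *
        Real.exp (-(u * c / (u + c) * x ^ 2)) := fun y => by
    rw [← Real.exp_add]
    congr 1
    field_simp
    ring
  simp_rw [this]
  rw [integral_mul_const, integral_sub_right_eq_self (fun y => Real.exp (-(u + c) * y ^ 2)),
    integral_gaussian]

theorem lintegral_gaussian_convolution {ι : Type*} [Fintype ι] {u : ℝ} (hu : 0 < u) {c : ι → ℝ}
    (hc : ∀ i, 0 < c i) (x : EuclideanSpace ℝ ι) :
    ∫⁻ y : EuclideanSpace ℝ ι,
        ENNReal.ofReal (Real.exp (-(u * ‖x - y‖ ^ 2 + ∑ i, c i * y i ^ 2))) =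
      ENNReal.ofReal
        (∏ i, √(Real.pi / (u + c i)) * Real.exp (-(u * c i / (u + c i) * x i ^ 2))) := by
  have h1 : ∫ y : ι → ℝ, ∏ i, Real.exp (-(u * (x i - y i) ^ 2 + c i * y i ^ 2)) =
      ∏ i, √(Real.pi / (u + c i)) * Real.exp (-(u * c i / (u + c i) * x i ^ 2)) := by
    rw [integral_fintype_prod_volume_eq_prod
      (f := fun i (y : ℝ) => Real.exp (-(u * (x i - y) ^ 2 + c i * y ^ 2)))]
    exact Finset.prod_congr rfl fun i _ => integral_gaussian_convolution hu (hc i) (x i)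
  have hpos : 0 < ∏ i, √(Real.pi / (u + c i)) * Real.exp (-(u * c i / (u + c i) * x i ^ 2)) :=
    Finset.prod_pos fun i _ => by
      have := hc i
      have := Real.pi_pos
      positivity
  have hi : Integrable fun y : ι → ℝ =>
      ∏ i, Real.exp (-(u * (x i - y i) ^ 2 + c i * y i ^ 2)) := by
    -- A non-integrable function has integral 0 by convention, whereas `h1` gives a positive value.
    by_contra hn
    rw [integral_undef hn] at h1
    exact hpos.ne h1
  rw [← (PiLp.volume_preserving_toLp ι).lintegral_comp_emb
    (MeasurableEquiv.toLp 2 (ι → ℝ)).measurableEmbedding, ← h1,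
    ofReal_integral_eq_lintegral_ofReal hi
      (.of_forall fun y => Finset.prod_nonneg fun i _ => (Real.exp_pos _).le)]
  refine lintegral_congr fun y => ?_
  rw [← Real.exp_sum, EuclideanSpace.norm_sq_eq, Finset.mul_sum, ← Finset.sum_add_distrib,
    ← Finset.sum_neg_distrib]
  simp

theorem lintegral_rpow_mul_exp_neg_mul_Ioi {s r : ℝ} (hs : 0 < s) (hr : 0 < r) :
    ∫⁻ u in Ioi (0 : ℝ), ENNReal.ofReal (u ^ (s - 1) * Real.exp (-(r * u))) =
      ENNReal.ofReal ((1 / r) ^ s * Real.Gamma s) := by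
  have h := Real.integral_rpow_mul_exp_neg_mul_Ioi hs hr
  have hpos : 0 < (1 / r) ^ s * Real.Gamma s := by
    have := Real.Gamma_pos_of_pos hs
    positivity
  have hi : IntegrableOn (fun u : ℝ => u ^ (s - 1) * Real.exp (-(r * u))) (Ioi 0) := by
    by_contra hn
    rw [integral_undef hn] at h
    exact hpos.ne h
  rw [← h, ofReal_integral_eq_lintegral_ofReal hi]
  filter_upwards [ae_restrict_mem measurableSet_Ioi] with u hu
  have : 0 < u := hu
  positivity

theorem lintegral_exp_neg_mul_Ioi {r : ℝ} (hr : 0 < r) :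
    ∫⁻ u in Ioi (0 : ℝ), ENNReal.ofReal (Real.exp (-(r * u))) = ENNReal.ofReal (1 / r) := by
  simpa using lintegral_rpow_mul_exp_neg_mul_Ioi one_pos hr

/-- Change of variables `t = c / u` on the half line. -/
theorem lintegral_Ioi_comp_const_div {c : ℝ} (hc : 0 < c) (g : ℝ → ℝ≥0∞) :
    ∫⁻ u in Ioi (0 : ℝ), ENNReal.ofReal (c / u ^ 2) * g (c / u) = ∫⁻ t in Ioi (0 : ℝ), g t := by
  have himg : (fun u : ℝ => c / u) '' Ioi 0 = Ioi 0 := by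
    ext t
    constructor
    · rintro ⟨u, hu, rfl⟩
      exact div_pos hc hu
    · intro ht
      have ht : 0 < t := ht
      exact ⟨c / t, div_pos hc ht, by field_simp⟩
  have hinj : InjOn (fun u : ℝ => c / u) (Ioi 0) := fun u hu v hv h => by
    have hu : 0 < u := hu
    have hv : 0 < v := hv
    have h : c / u = c / v := h
    field_simp at h
    exact h.symm
  have hd : ∀ u ∈ Ioi (0 : ℝ), HasDerivWithinAt (fun u : ℝ => c / u) (-c / u ^ 2) (Ioi 0) u :=
    fun u hu => by
      have hu : u ≠ 0 := ne_of_gt hu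
      simpa [div_eq_mul_inv] using ((hasDerivAt_inv hu).const_mul c).hasDerivWithinAt
  have := lintegral_image_eq_lintegral_abs_deriv_mul measurableSet_Ioi hd hinj g
  rw [himg] at this
  rw [this]
  refine setLIntegral_congr_fun measurableSet_Ioi fun u hu => ?_
  have hu : 0 < u := hu
  rw [neg_div, abs_neg, abs_of_pos (by positivity)]

/-! ### Confocal quadratic forms and the parameter `τ`. -/

variable {N : ℕ} {a : Fin N → ℝ}

/-- The quadratic form `A_t x · x`. -/
noncomputable def quadForm (a : Fin N → ℝ) (t : ℝ) (x : EuclideanSpace ℝ (Fin N)) : ℝ :=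
  ∑ i, x i ^ 2 / (a i ^ 2 + t)

lemma inner_matA_eq_quadForm (t : ℝ) (x : EuclideanSpace ℝ (Fin N)) :
    inner ℝ (Matrix.toEuclideanLin (matA a t) x) x = quadForm a t x := by
  simp only [PiLp.inner_apply, matA, quadForm, Matrix.toLpLin_apply, Matrix.mulVec_diagonal]
  refine Finset.sum_congr rfl fun i _ => ?_
  simp
  ring

lemma norm_phi_sq_eq_quadForm {t : ℝ} (ht : 0 ≤ t) (x : EuclideanSpace ℝ (Fin N)) :
    ‖phi a t x‖ ^ 2 = quadForm a t x := by
  simp only [EuclideanSpace.norm_sq_eq, phi, sqrtMatA, quadForm, Matrix.toLpLin_apply,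
    Matrix.mulVec_diagonal]
  refine Finset.sum_congr rfl fun i _ => ?_
  rw [Real.norm_eq_abs, sq_abs, mul_pow, div_pow, Real.sq_sqrt (by positivity)]
  ring

lemma ellipsoid_eq {t : ℝ} (ht : 0 ≤ t) : ellipsoid a t = {x | quadForm a t x ≤ 1} := by
  ext x
  simp only [ellipsoid, mem_ofPred_eq, norm_phi_sq_eq_quadForm ht]

lemma potentialIntegrand_eq (x : EuclideanSpace ℝ (Fin N)) (t : ℝ) :
    potentialIntegrand a x t = gammaWeight a t * (1 - quadForm a t x) := by
  rw [potentialIntegrand, inner_matA_eq_quadForm]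

@[fun_prop]
lemma continuous_quadForm (t : ℝ) : Continuous (quadForm a t) := by
  unfold quadForm
  fun_prop

lemma quadForm_smul (t c : ℝ) (x : EuclideanSpace ℝ (Fin N)) :
    quadForm a t (c • x) = c ^ 2 * quadForm a t x := by
  simp only [quadForm, PiLp.smul_apply, smul_eq_mul, Finset.mul_sum]
  exact Finset.sum_congr rfl fun i _ => by ring

lemma quadForm_nonneg {t : ℝ} (ht : 0 ≤ t) (x : EuclideanSpace ℝ (Fin N)) :
    0 ≤ quadForm a t x :=
  Finset.sum_nonneg fun i _ => by positivity

lemma isClosed_ellipsoid {t : ℝ} (ht : 0 ≤ t) : IsClosed (ellipsoid a t) := by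
  rw [ellipsoid_eq ht]
  exact isClosed_le (by fun_prop) continuous_const

lemma mem_frontier_ellipsoid {t : ℝ} (ht : 0 ≤ t) {x : EuclideanSpace ℝ (Fin N)} :
    x ∈ frontier (ellipsoid a t) ↔ quadForm a t x = 1 := by
  constructor
  · intro h
    rw [ellipsoid_eq ht] at h
    exact frontier_le_subset_eq (continuous_quadForm t) continuous_const h
  · intro h
    rw [(isClosed_ellipsoid ht).frontier_eq, ellipsoid_eq ht]
    refine ⟨h.le, fun hx => ?_⟩
    -- An interior point could be dilated by some `c > 1` without leaving the ellipsoid, but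
    -- homogeneity gives the value `c² > 1` there.
    have hc : ContinuousAt (fun c : ℝ => c • x) 1 := by fun_prop
    have hev := hc.eventually (by simpa [Filter.Eventually] using mem_interior_iff_mem_nhds.1 hx)
    obtain ⟨c, hc1, hcq⟩ :=
      ((hev.filter_mono nhdsWithin_le_nhds).and (self_mem_nhdsWithin (s := Ioi (1 : ℝ)))).exists
    have hc1 : quadForm a t (c • x) ≤ 1 := hc1
    have hcq : 1 < c := hcq
    rw [quadForm_smul, h] at hc1
    nlinarith

lemma quadForm_strictAntiOn (ha : ∀ i, 0 < a i) {x : EuclideanSpace ℝ (Fin N)} (hx : x ≠ 0) :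
    StrictAntiOn (fun t => quadForm a t x) (Ici 0) := by
  intro s hs t ht hst
  have hs : 0 ≤ s := hs
  obtain ⟨i, hi⟩ : ∃ i, x i ≠ 0 := by
    by_contra! h
    exact hx (by ext i; simp [h i])
  refine Finset.sum_lt_sum (fun j _ => ?_) ⟨i, Finset.mem_univ _, ?_⟩
  · have := ha j
    gcongr
  · have := ha i
    gcongr

lemma continuousOn_quadForm_param (ha : ∀ i, 0 < a i) (x : EuclideanSpace ℝ (Fin N)) :
    ContinuousOn (fun t => quadForm a t x) (Ici 0) := by
  unfold quadForm
  refine continuousOn_finsetSum _ fun i _ => ?_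
  refine ContinuousOn.div (by fun_prop) (by fun_prop) fun t ht => ?_
  have := ha i
  have ht : 0 ≤ t := ht
  positivity

lemma exists_quadForm_eq_one (ha : ∀ i, 0 < a i) {x : EuclideanSpace ℝ (Fin N)}
    (hx : 1 < quadForm a 0 x) : ∃ t, 0 ≤ t ∧ quadForm a t x = 1 := by
  -- Dropping each `a i ^ 2` from the denominators leaves `‖x‖² / (‖x‖² + 1)`, up to the added 1.
  have hT : quadForm a (‖x‖ ^ 2 + 1) x ≤ 1 := by
    calc quadForm a (‖x‖ ^ 2 + 1) x ≤ ∑ i, x i ^ 2 / (‖x‖ ^ 2 + 1) := by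
          refine Finset.sum_le_sum fun i _ => ?_
          exact div_le_div_of_nonneg_left (sq_nonneg _) (by positivity)
            (by linarith [sq_nonneg (a i)])
      _ = ‖x‖ ^ 2 / (‖x‖ ^ 2 + 1) := by
          rw [← Finset.sum_div, EuclideanSpace.norm_sq_eq]
          simp
      _ ≤ 1 := by
          rw [div_le_one (by positivity)]
          linarith
  have hsub : Icc 0 (‖x‖ ^ 2 + 1) ⊆ Ici (0 : ℝ) := fun t ht => ht.1
  obtain ⟨t, ht, h⟩ := intermediate_value_Icc' (by positivity)
    ((continuousOn_quadForm_param ha x).mono hsub) ⟨hT, hx.le⟩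
  exact ⟨t, ht.1, h⟩

lemma quadForm_zero_right (t : ℝ) : quadForm a t 0 = 0 := by simp [quadForm]

theorem isConfocalParameter_iff (τ : EuclideanSpace ℝ (Fin N) → ℝ) :
    IsConfocalParameter a τ ↔ ∀ x, 0 ≤ τ x ∧ (quadForm a 0 x ≤ 1 → τ x = 0) ∧
      (1 < quadForm a 0 x → quadForm a (τ x) x = 1) := by
  rw [IsConfocalParameter, (isClosed_ellipsoid le_rfl).closure_eq, ellipsoid_eq le_rfl]
  simp only [mem_compl_iff, mem_ofPred_eq, not_le]
  constructor
  · rintro ⟨h0, h1, h2⟩ x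
    exact ⟨h0 x, h1 x, fun hx => (mem_frontier_ellipsoid (h0 x)).1 (h2 x hx)⟩
  · intro h
    exact ⟨fun x => (h x).1, fun x => (h x).2.1,
      fun x hx => (mem_frontier_ellipsoid (h x).1).2 ((h x).2.2 hx)⟩

/-- Outside the ellipsoid, `t ↦ q_t(x)` starts above 1, is continuous and strictly decreasing, and
eventually falls to 1 or below. -/
theorem existsUnique_isConfocalParameter (ha : ∀ i, 0 < a i) :
    ∃! τ : EuclideanSpace ℝ (Fin N) → ℝ, IsConfocalParameter a τ := by
  simp only [isConfocalParameter_iff]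
  have hne : ∀ x : EuclideanSpace ℝ (Fin N), 1 < quadForm a 0 x → x ≠ 0 := by
    rintro x hx rfl
    rw [quadForm_zero_right] at hx
    linarith
  have hex : ∀ x : EuclideanSpace ℝ (Fin N), ∃ t, 0 ≤ t ∧ (quadForm a 0 x ≤ 1 → t = 0) ∧
      (1 < quadForm a 0 x → quadForm a t x = 1) := fun x => by
    rcases le_or_gt (quadForm a 0 x) 1 with hx | hx
    · exact ⟨0, le_rfl, fun _ => rfl, fun h => absurd hx h.not_ge⟩
    · obtain ⟨t, ht, h⟩ := exists_quadForm_eq_one ha hx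
      exact ⟨t, ht, fun h' => absurd hx h'.not_gt, fun _ => h⟩
  choose τ hτ using hex
  refine ⟨τ, hτ, fun σ hσ => funext fun x => ?_⟩
  rcases le_or_gt (quadForm a 0 x) 1 with hx | hx
  · rw [(hσ x).2.1 hx, (hτ x).2.1 hx]
  · exact (quadForm_strictAntiOn ha (hne x hx)).injOn (hσ x).1 (hτ x).1
      (((hσ x).2.2 hx).trans ((hτ x).2.2 hx).symm)

/-- Among the parameters `t > 0`, those with `A_t x · x ≤ 1` are the ones beyond `τ x`. -/
theorem IsConfocalParameter.quadForm_le_one_iff (ha : ∀ i, 0 < a i)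
    {τ : EuclideanSpace ℝ (Fin N) → ℝ} (hτ : IsConfocalParameter a τ)
    (x : EuclideanSpace ℝ (Fin N)) {t : ℝ} (ht : 0 < t) : quadForm a t x ≤ 1 ↔ τ x ≤ t := by
  obtain ⟨h0, h1, h2⟩ := (isConfocalParameter_iff τ).1 hτ x
  rcases eq_or_ne x 0 with rfl | hne
  · rw [h1 (by simp [quadForm_zero_right])]
    simp [quadForm_zero_right, ht.le]
  have hanti := quadForm_strictAntiOn ha hne
  rcases le_or_gt (quadForm a 0 x) 1 with hx | hx
  · rw [h1 hx]
    exact ⟨fun _ => ht.le, fun _ =>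
      (hanti (mem_Ici.2 le_rfl) (mem_Ici.2 ht.le) ht).le.trans hx⟩
  · rw [← h2 hx]
    exact hanti.le_iff_ge (mem_Ici.2 ht.le) (mem_Ici.2 h0)

/-! ### The potential of a Gaussian density. -/

lemma gammaWeight_pos (ha : ∀ i, 0 < a i) {t : ℝ} (ht : 0 ≤ t) : 0 < gammaWeight a t :=
  Finset.prod_pos fun i _ => by
    have := ha i
    positivity

@[fun_prop]
lemma measurable_gammaWeight : Measurable (gammaWeight a) := by
  unfold gammaWeight
  fun_prop

@[fun_prop]
lemma measurable_quadForm_param (x : EuclideanSpace ℝ (Fin N)) :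
    Measurable fun t => quadForm a t x := by
  unfold quadForm
  fun_prop

lemma prod_gaussian_factors (ha : ∀ i, 0 < a i) {l u : ℝ} (hl : 0 < l) (hu : 0 < u)
    (x : EuclideanSpace ℝ (Fin N)) :
    ∏ i, √(Real.pi / (u + l / a i ^ 2)) *
        Real.exp (-(u * (l / a i ^ 2) / (u + l / a i ^ 2) * x i ^ 2)) =
      √(Real.pi / u) ^ N *
        (gammaWeight a (l / u) * Real.exp (-(l * quadForm a (l / u) x))) := by
  rw [Finset.prod_mul_distrib, ← mul_assoc, ← Real.exp_sum, quadForm, Finset.mul_sum,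
    ← Finset.sum_neg_distrib, gammaWeight,
    show √(Real.pi / u) ^ N = ∏ _i : Fin N, √(Real.pi / u) by simp, ← Finset.prod_mul_distrib]
  congr 1
  · refine Finset.prod_congr rfl fun i _ => ?_
    have hi := ha i
    nth_rw 2 [← Real.sqrt_sq hi.le]
    rw [← Real.sqrt_div (sq_nonneg _), ← Real.sqrt_mul (by positivity)]
    congr 1
    field_simp
  · congr 1
    refine Finset.sum_congr rfl fun i _ => ?_
    have hi := ha i
    field_simp

lemma one_div_norm_sq_rpow (hN : 3 ≤ N) (r : ℝ) (hr : 0 ≤ r) :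
    (1 / r ^ 2) ^ ((N : ℝ) / 2 - 1) = 1 / r ^ (N - 2) := by
  have h2 : ((N - 2 : ℕ) : ℝ) = N - 2 := by push_cast [show 2 ≤ N by omega]; rfl
  rw [Real.div_rpow zero_le_one (by positivity), Real.one_rpow, ← Real.rpow_natCast r 2,
    ← Real.rpow_mul hr, ← Real.rpow_natCast r (N - 2), h2]
  congr 2
  push_cast
  ring

/-- The powers of `u` from the Gamma integral and from the Gaussian normalization combine to `u⁻²`,
the Jacobian factor of `t = l / u`. -/
lemma rpow_mul_sqrt_pow {u : ℝ} (hu : 0 < u) :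
    u ^ ((N : ℝ) / 2 - 1 - 1) * √(Real.pi / u) ^ N = √Real.pi ^ N / u ^ 2 := by
  have h : √u ^ N = u ^ ((N : ℝ) / 2) := by
    rw [Real.sqrt_eq_rpow, ← Real.rpow_natCast, ← Real.rpow_mul hu.le]
    congr 1; ring
  have h' : u ^ ((N : ℝ) / 2) = u ^ ((N : ℝ) / 2 - 1 - 1) * u ^ 2 := by
    rw [← Real.rpow_natCast u 2, ← Real.rpow_add hu]
    congr 1; push_cast; ring
  rw [Real.sqrt_div Real.pi_pos.le, div_pow, h, h']
  have := Real.rpow_pos_of_pos hu ((N : ℝ) / 2 - 1 - 1)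
  field_simp

/-- The potential of the density `y ↦ exp (-l A_0 y · y)`. -/
theorem lintegral_riesz_mul_exp_neg_quadForm (hN : 3 ≤ N) (ha : ∀ i, 0 < a i) {l : ℝ} (hl : 0 < l)
    (x : EuclideanSpace ℝ (Fin N)) :
    ENNReal.ofReal (Real.Gamma ((N : ℝ) / 2 - 1)) * ∫⁻ y : EuclideanSpace ℝ (Fin N),
        ENNReal.ofReal (1 / ‖x - y‖ ^ (N - 2)) *
          ENNReal.ofReal (Real.exp (-(l * quadForm a 0 y))) =
      ENNReal.ofReal (√Real.pi ^ N / l) * ∫⁻ t in Ioi (0 : ℝ),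
        ENNReal.ofReal (gammaWeight a t * Real.exp (-(l * quadForm a t x))) := by
  have hNr : (3 : ℝ) ≤ N := by exact_mod_cast hN
  have hs : 0 < (N : ℝ) / 2 - 1 := by linarith
  have : Nonempty (Fin N) := ⟨⟨0, by omega⟩⟩
  set s := (N : ℝ) / 2 - 1 with hsdef
  calc _ = ∫⁻ y : EuclideanSpace ℝ (Fin N), ∫⁻ u in Ioi (0 : ℝ), ENNReal.ofReal (u ^ (s - 1)) *
        ENNReal.ofReal (Real.exp (-(u * ‖x - y‖ ^ 2 + ∑ i, l / a i ^ 2 * y i ^ 2))) := by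
        rw [← lintegral_const_mul _ (by fun_prop)]
        refine lintegral_congr_ae ?_
        filter_upwards [Measure.ae_ne volume x] with y hy
        -- The Gamma representation of the kernel needs `y ≠ x`; the excluded point is null.
        have hr : 0 < ‖x - y‖ := norm_pos_iff.2 (sub_ne_zero.2 hy.symm)
        rw [← mul_assoc, ← ENNReal.ofReal_mul (Real.Gamma_pos_of_pos hs).le, mul_comm (Real.Gamma s),
          ← one_div_norm_sq_rpow hN _ hr.le,
          ← lintegral_rpow_mul_exp_neg_mul_Ioi hs (by positivity),
          ← lintegral_mul_const _ (by fun_prop)]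
        refine setLIntegral_congr_fun measurableSet_Ioi fun u hu => ?_
        have hu : 0 < u := hu
        rw [← ENNReal.ofReal_mul (by positivity), ← ENNReal.ofReal_mul (by positivity), mul_assoc,
          ← Real.exp_add, quadForm, Finset.mul_sum]
        congr 3
        rw [neg_add]
        congr 2
        · ring
        · congr 1
          funext i
          ring
    _ = ∫⁻ u in Ioi (0 : ℝ), ∫⁻ y : EuclideanSpace ℝ (Fin N), ENNReal.ofReal (u ^ (s - 1)) *
        ENNReal.ofReal (Real.exp (-(u * ‖x - y‖ ^ 2 + ∑ i, l / a i ^ 2 * y i ^ 2))) :=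
        lintegral_lintegral_swap (by fun_prop)
    _ = ∫⁻ u in Ioi (0 : ℝ), ENNReal.ofReal (√Real.pi ^ N / l) * (ENNReal.ofReal (l / u ^ 2) *
        ENNReal.ofReal (gammaWeight a (l / u) * Real.exp (-(l * quadForm a (l / u) x)))) := by
        refine setLIntegral_congr_fun measurableSet_Ioi fun u hu => ?_
        have hu : 0 < u := hu
        rw [lintegral_const_mul _ (by fun_prop), lintegral_gaussian_convolution hu
          (fun i => div_pos hl (pow_pos (ha i) 2)), prod_gaussian_factors ha hl hu,
          ← ENNReal.ofReal_mul (by positivity), ← mul_assoc, rpow_mul_sqrt_pow hu,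
          ← ENNReal.ofReal_mul (by positivity), ← ENNReal.ofReal_mul (by positivity), ← mul_assoc]
        congr 1
        field_simp
    _ = _ := by
        rw [lintegral_const_mul _ (by fun_prop), lintegral_Ioi_comp_const_div hl
          (fun t => ENNReal.ofReal (gammaWeight a t * Real.exp (-(l * quadForm a t x))))]

/-! ### Convergence of the integrals in `t`. -/

/-- The weight is at most 1 on `(0, 1]` and at most a constant times `t^(-N/2)` beyond, with `N/2 >
1`. -/
theorem integrableOn_gammaWeight (hN : 3 ≤ N) (ha : ∀ i, 0 < a i) :
    IntegrableOn (gammaWeight a) (Ioi 0) := by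
  rw [← Ioc_union_Ioi_eq_Ioi (zero_le_one' ℝ)]
  refine IntegrableOn.union ?_ ?_
  · refine Measure.integrableOn_of_bounded (M := 1) (by simp)
      measurable_gammaWeight.aestronglyMeasurable ?_
    filter_upwards [ae_restrict_mem measurableSet_Ioc] with t ht
    rw [Real.norm_of_nonneg (gammaWeight_pos ha ht.1.le).le]
    refine Finset.prod_le_one (fun i _ => by have := ha i; positivity) fun i _ => ?_
    have := ha i
    have := ht.1
    rw [div_le_one (by positivity)]
    exact Real.le_sqrt_of_sq_le (by linarith)
  · have hNr : (3 : ℝ) ≤ N := by exact_mod_cast hN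
    have hi := (integrableOn_Ioi_rpow_of_lt (a := -((N : ℝ) / 2)) (c := 1) (by linarith)
      one_pos).const_mul (∏ i, a i)
    refine hi.mono' measurable_gammaWeight.aestronglyMeasurable ?_
    filter_upwards [ae_restrict_mem measurableSet_Ioi] with t ht
    have ht : 1 < t := ht
    have ht0 : 0 < t := by linarith
    rw [Real.norm_of_nonneg (gammaWeight_pos ha ht0.le).le, Real.rpow_neg ht0.le,
      show t ^ ((N : ℝ) / 2) = √t ^ N by
        rw [Real.sqrt_eq_rpow, ← Real.rpow_natCast, ← Real.rpow_mul ht0.le]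
        congr 1; ring, gammaWeight, Finset.prod_div_distrib, div_eq_mul_inv]
    have hp : 0 ≤ ∏ i, a i := Finset.prod_nonneg fun i _ => (ha i).le
    refine mul_le_mul_of_nonneg_left (inv_anti₀ (by positivity) ?_) hp
    calc √t ^ N = ∏ _i : Fin N, √t := by simp
      _ ≤ _ := Finset.prod_le_prod (fun i _ => by positivity) fun i _ =>
        Real.sqrt_le_sqrt (by linarith [sq_nonneg (a i)])

theorem integrableOn_gammaWeight_div (hN : 3 ≤ N) (ha : ∀ i, 0 < a i) (i : Fin N) :
    IntegrableOn (fun t => gammaWeight a t / (a i ^ 2 + t)) (Ioi 0) := by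
  refine ((integrableOn_gammaWeight hN ha).div_const (a i ^ 2)).mono'
    (Measurable.aestronglyMeasurable (by fun_prop)) ?_
  filter_upwards [ae_restrict_mem measurableSet_Ioi] with t ht
  have ht : 0 < t := ht
  have := ha i
  have := gammaWeight_pos ha ht.le
  rw [Real.norm_of_nonneg (by positivity)]
  gcongr
  linarith

lemma potentialIntegrand_eq_sub_sum (x : EuclideanSpace ℝ (Fin N)) :
    potentialIntegrand a x =
      fun t => gammaWeight a t - ∑ i, gammaWeight a t / (a i ^ 2 + t) * x i ^ 2 := by
  funext t
  rw [potentialIntegrand_eq, quadForm, mul_sub, mul_one, Finset.mul_sum]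
  congr 1
  exact Finset.sum_congr rfl fun i _ => by ring

theorem integrableOn_potentialIntegrand (hN : 3 ≤ N) (ha : ∀ i, 0 < a i)
    (x : EuclideanSpace ℝ (Fin N)) : IntegrableOn (potentialIntegrand a x) (Ioi 0) := by
  rw [potentialIntegrand_eq_sub_sum]
  exact (integrableOn_gammaWeight hN ha).sub
    (integrable_finsetSum _ fun i _ => (integrableOn_gammaWeight_div hN ha i).mul_const _)

theorem setIntegral_potentialIntegrand (hN : 3 ≤ N) (ha : ∀ i, 0 < a i)
    (x : EuclideanSpace ℝ (Fin N)) :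
    ∫ t in Ioi 0, potentialIntegrand a x t = (∫ t in Ioi (0 : ℝ), gammaWeight a t) -
      ∑ i, (∫ t in Ioi (0 : ℝ), gammaWeight a t / (a i ^ 2 + t)) * x i ^ 2 := by
  rw [potentialIntegrand_eq_sub_sum, integral_sub (integrableOn_gammaWeight hN ha)
    (integrable_finsetSum _ fun i _ => (integrableOn_gammaWeight_div hN ha i).mul_const _),
    integral_finsetSum _ fun i _ => (integrableOn_gammaWeight_div hN ha i).mul_const _]
  simp only [integral_mul_const]

/-! ### From Gaussian densities to the ellipsoid. -/

/-- The potential of the ellipsoid, up to normalization, as an integral of nonnegative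
functions. -/
theorem lintegral_riesz_ellipsoid (hN : 3 ≤ N) (ha : ∀ i, 0 < a i)
    (x : EuclideanSpace ℝ (Fin N)) :
    ENNReal.ofReal (Real.Gamma ((N : ℝ) / 2 - 1)) *
        ∫⁻ y in ellipsoid a 0, ENNReal.ofReal (1 / ‖x - y‖ ^ (N - 2)) =
      ENNReal.ofReal (√Real.pi ^ N) *
        ∫⁻ t in Ioi (0 : ℝ), ENNReal.ofReal (gammaWeight a t) *
          ENNReal.ofReal (1 - quadForm a t x) := by
  set κ := ENNReal.ofReal (Real.Gamma ((N : ℝ) / 2 - 1)) with hκ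
  set ϖ := ENNReal.ofReal (√Real.pi ^ N) with hϖ
  set μ := κ • (volume : Measure (EuclideanSpace ℝ (Fin N))).withDensity
    fun y => ENNReal.ofReal (1 / ‖x - y‖ ^ (N - 2)) with hμ
  set γ := (volume.restrict (Ioi (0 : ℝ))).withDensity
    fun t => ENNReal.ofReal (gammaWeight a t) with hγ
  set ν := ϖ • γ.prod (volume.restrict (Ioi (0 : ℝ))) with hν
  have hwm : Measurable fun y : EuclideanSpace ℝ (Fin N) =>
    ENNReal.ofReal (1 / ‖x - y‖ ^ (N - 2)) := by fun_prop
  have hγm : Measurable fun t => ENNReal.ofReal (gammaWeight a t) := by fun_prop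
  have hν_lap : ∀ {l : ℝ}, 0 < l →
      ∫⁻ p, ENNReal.ofReal (Real.exp (-(l * (quadForm a p.1 x + p.2)))) ∂ν =
        ENNReal.ofReal (√Real.pi ^ N / l) * ∫⁻ t in Ioi (0 : ℝ),
          ENNReal.ofReal (gammaWeight a t * Real.exp (-(l * quadForm a t x))) := fun {l} hl => by
    rw [hν, lintegral_smul_measure, lintegral_prod _ (by fun_prop), hγ,
      lintegral_withDensity_eq_lintegral_mul _ hγm (by fun_prop), smul_eq_mul, div_eq_mul_one_div,
      ENNReal.ofReal_mul (by positivity), mul_assoc,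
      ← lintegral_const_mul (ENNReal.ofReal (1 / l)) (by fun_prop)]
    congr 1
    refine setLIntegral_congr_fun measurableSet_Ioi fun t ht => ?_
    have ht : 0 < t := ht
    have hs : ∀ s : ℝ, ENNReal.ofReal (Real.exp (-(l * (quadForm a t x + s)))) =
        ENNReal.ofReal (Real.exp (-(l * quadForm a t x))) *
          ENNReal.ofReal (Real.exp (-(l * s))) := fun s => by
      rw [← ENNReal.ofReal_mul (by positivity), ← Real.exp_add]
      congr 2; ring
    simp only [Pi.mul_apply, hs]
    rw [lintegral_const_mul _ (by fun_prop), lintegral_exp_neg_mul_Ioi hl,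
      ENNReal.ofReal_mul (gammaWeight_pos ha ht.le).le]
    ring
  have hμ_lap : ∀ {l : ℝ}, 0 < l →
      ∫⁻ y, ENNReal.ofReal (Real.exp (-(l * quadForm a 0 y))) ∂μ =
        ENNReal.ofReal (√Real.pi ^ N / l) * ∫⁻ t in Ioi (0 : ℝ),
          ENNReal.ofReal (gammaWeight a t * Real.exp (-(l * quadForm a t x))) := fun {l} hl => by
    rw [← lintegral_riesz_mul_exp_neg_quadForm hN ha hl, hμ, lintegral_smul_measure,
      lintegral_withDensity_eq_lintegral_mul _ hwm (by fun_prop), smul_eq_mul]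
    rfl
  have hγ_ac : γ ≪ volume.restrict (Ioi (0 : ℝ)) := withDensity_absolutelyContinuous _ _
  -- Level 1 is the one that cuts out the ellipsoid.
  have key := measure_le_eq_of_lintegral_exp_neg_eq (μ := μ) (ν := ν) (f := quadForm a 0)
    (g := fun p : ℝ × ℝ => quadForm a p.1 x + p.2) (c := 1) (by fun_prop) (by fun_prop)
    (.of_forall fun y => quadForm_nonneg le_rfl y)
    (by
      refine Measure.ae_smul_measure ?_ ϖ
      have h1 : ∀ᵐ p ∂γ.prod (volume.restrict (Ioi (0 : ℝ))), p.1 ∈ Ioi (0 : ℝ) :=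
        Measure.quasiMeasurePreserving_fst.ae (p := (· ∈ Ioi (0 : ℝ))) (hγ_ac.ae_le (ae_restrict_mem measurableSet_Ioi))
      have h2 : ∀ᵐ p ∂γ.prod (volume.restrict (Ioi (0 : ℝ))), p.2 ∈ Ioi (0 : ℝ) :=
        Measure.quasiMeasurePreserving_snd.ae (p := (· ∈ Ioi (0 : ℝ)))
          (ae_restrict_mem measurableSet_Ioi)
      filter_upwards [h1, h2] with p hp1 hp2
      exact add_nonneg (quadForm_nonneg (le_of_lt hp1) x) (le_of_lt hp2))
    (fun n => by rw [hμ_lap (by positivity), hν_lap (by positivity)])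
    (by
      have := hμ_lap one_pos
      simp only [one_mul] at this
      rw [this]
      refine ENNReal.mul_ne_top ENNReal.ofReal_ne_top (ne_top_of_le_ne_top
        ((hasFiniteIntegral_iff_ofReal ?_).1 (integrableOn_gammaWeight hN ha).2).ne
        (setLIntegral_mono' measurableSet_Ioi fun t ht => ENNReal.ofReal_le_ofReal ?_))
      · filter_upwards [ae_restrict_mem measurableSet_Ioi] with t ht
        exact (gammaWeight_pos ha (le_of_lt ht)).le
      · have ht : 0 < t := ht
        refine mul_le_of_le_one_right (gammaWeight_pos ha ht.le).le (Real.exp_le_one_iff.2 ?_)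
        simpa using quadForm_nonneg ht.le x)
    zero_le_one
  have hset : MeasurableSet {y : EuclideanSpace ℝ (Fin N) | quadForm a 0 y ≤ 1} :=
    measurableSet_le (by fun_prop) measurable_const
  have hset2 : MeasurableSet {p : ℝ × ℝ | quadForm a p.1 x + p.2 ≤ 1} :=
    measurableSet_le (by fun_prop) measurable_const
  rw [hμ, hν, Measure.smul_apply, Measure.smul_apply, withDensity_apply _ hset,
    Measure.prod_apply hset2, hγ, lintegral_withDensity_eq_lintegral_mul _ hγm
      (measurable_measure_prodMk_left hset2), smul_eq_mul, smul_eq_mul] at key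
  rw [ellipsoid_eq le_rfl, key]
  congr 1
  refine lintegral_congr fun t => ?_
  rw [Pi.mul_apply]
  congr 1
  -- The slice over `t` is an interval of length `(1 - q_t(x))₊`; `ENNReal.ofReal` takes the
  -- positive part.
  rw [Measure.restrict_apply (measurable_prodMk_left hset2),
    show Prod.mk t ⁻¹' {p : ℝ × ℝ | quadForm a p.1 x + p.2 ≤ 1} ∩ Ioi 0 =
      Ioc 0 (1 - quadForm a t x) by
    ext s
    simp only [mem_inter_iff, mem_preimage, mem_ofPred_eq, mem_Ioi, mem_Ioc]
    constructor <;> rintro ⟨h1, h2⟩ <;> constructor <;> linarith, Real.volume_Ioc, sub_zero]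

/-! ### Normalization and return to real integrals. -/

/-- The sphere has `N` times the volume of the unit ball, and the recurrence of `Γ` applied twice
lowers `N/2 + 1` to `N/2 - 1`. -/
lemma sphereArea_normalization (hN : 3 ≤ N) :
    (((N : ℝ) - 2) * sphereArea N)⁻¹ =
      Real.Gamma ((N : ℝ) / 2 - 1) / (4 * √Real.pi ^ N) := by
  have hNr : (3 : ℝ) ≤ N := by exact_mod_cast hN
  have : Nonempty (Fin N) := ⟨⟨0, by omega⟩⟩
  have hs : 0 < (N : ℝ) / 2 - 1 := by linarith
  have hΓ := Real.Gamma_pos_of_pos hs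
  have h1 : Real.Gamma ((N : ℝ) / 2 + 1) =
      (N : ℝ) / 2 * (((N : ℝ) / 2 - 1) * Real.Gamma ((N : ℝ) / 2 - 1)) := by
    rw [Real.Gamma_add_one (by linarith), ← Real.Gamma_add_one hs.ne', sub_add_cancel]
  have hN2 : (N : ℝ) - 2 ≠ 0 := by linarith
  have hπ := Real.pi_pos
  rw [sphereArea, Measure.toSphere_real_apply_univ, measureReal_def, EuclideanSpace.volume_ball,
    Fintype.card_fin, finrank_euclideanSpace_fin, h1, ENNReal.ofReal_one, one_pow, one_mul,
    ENNReal.toReal_ofReal (by positivity)]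
  have h3 : (N : ℝ) / 2 - 1 = (N - 2) / 2 := by ring
  generalize Real.Gamma ((N : ℝ) / 2 - 1) = G at *
  rw [h3]
  have : (N : ℝ) ≠ 0 := by linarith
  field_simp
  ring

theorem setLIntegral_gammaWeight_ne_top (hN : 3 ≤ N) (ha : ∀ i, 0 < a i)
    (x : EuclideanSpace ℝ (Fin N)) :
    ∫⁻ t in Ioi (0 : ℝ), ENNReal.ofReal (gammaWeight a t) *
      ENNReal.ofReal (1 - quadForm a t x) ≠ ∞ := by
  refine ne_top_of_le_ne_top
    ((hasFiniteIntegral_iff_ofReal ?_).1 (integrableOn_gammaWeight hN ha).2).ne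
    (setLIntegral_mono' measurableSet_Ioi fun t ht => ?_)
  · filter_upwards [ae_restrict_mem measurableSet_Ioi] with t ht
    exact (gammaWeight_pos ha (le_of_lt ht)).le
  · refine mul_le_of_le_one_right' (ENNReal.ofReal_le_one.2 ?_)
    linarith [quadForm_nonneg (a := a) (le_of_lt ht) x]

/-- Finiteness is read off from the other side of `lintegral_riesz_ellipsoid`, since the factor
`Γ(N/2-1)` is nonzero. -/
theorem integrableOn_riesz_ellipsoid (hN : 3 ≤ N) (ha : ∀ i, 0 < a i)
    (x : EuclideanSpace ℝ (Fin N)) :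
    IntegrableOn (fun y => 1 / ‖x - y‖ ^ (N - 2)) (ellipsoid a 0) := by
  have hNr : (3 : ℝ) ≤ N := by exact_mod_cast hN
  have hΓ := Real.Gamma_pos_of_pos (show 0 < (N : ℝ) / 2 - 1 by linarith)
  refine ⟨Measurable.aestronglyMeasurable (by fun_prop), ?_⟩
  rw [hasFiniteIntegral_iff_ofReal (.of_forall fun y => by positivity), lt_top_iff_ne_top]
  intro h
  have := lintegral_riesz_ellipsoid hN ha x
  rw [h, ENNReal.mul_top (by simpa using hΓ)] at this
  exact ENNReal.mul_ne_top ENNReal.ofReal_ne_top (setLIntegral_gammaWeight_ne_top hN ha x) this.symm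

theorem toReal_setLIntegral_gammaWeight (hN : 3 ≤ N) (ha : ∀ i, 0 < a i)
    {τ : EuclideanSpace ℝ (Fin N) → ℝ} (hτ : IsConfocalParameter a τ)
    (x : EuclideanSpace ℝ (Fin N)) :
    (∫⁻ t in Ioi (0 : ℝ), ENNReal.ofReal (gammaWeight a t) *
      ENNReal.ofReal (1 - quadForm a t x)).toReal =
    ∫ t in Ioi (τ x), potentialIntegrand a x t := by
  have hτ0 := hτ.1 x
  have hint := (integrableOn_potentialIntegrand hN ha x).mono_set (Ioi_subset_Ioi hτ0)
  rw [integral_eq_lintegral_of_nonneg_ae _ hint.1]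
  · congr 1
    rw [← Ioc_union_Ioi_eq_Ioi hτ0, lintegral_union measurableSet_Ioi
      (Ioc_disjoint_Ioi le_rfl)]
    have h0 : ∫⁻ t in Ioc 0 (τ x), ENNReal.ofReal (gammaWeight a t) *
        ENNReal.ofReal (1 - quadForm a t x) = 0 := by
      -- The endpoint `t = τ x` is dropped because `q_t(x) > 1` holds only strictly below it.
      rw [setLIntegral_congr Ioo_ae_eq_Ioc.symm]
      refine setLIntegral_eq_zero measurableSet_Ioo fun t ht => ?_
      have : ¬ quadForm a t x ≤ 1 := by
        rw [hτ.quadForm_le_one_iff ha x ht.1]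
        exact ht.2.not_ge
      rw [ENNReal.ofReal_of_nonpos (p := 1 - quadForm a t x) (by linarith), mul_zero]
      rfl
    rw [h0, zero_add]
    refine setLIntegral_congr_fun measurableSet_Ioi fun t ht => ?_
    rw [potentialIntegrand_eq,
      ENNReal.ofReal_mul (gammaWeight_pos ha (hτ0.trans (le_of_lt ht))).le]
  · filter_upwards [ae_restrict_mem measurableSet_Ioi] with t ht
    have ht : τ x < t := ht
    have ht0 : 0 < t := hτ0.trans_lt ht
    rw [potentialIntegrand_eq]
    exact mul_nonneg (gammaWeight_pos ha ht0.le).le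
      (sub_nonneg.2 ((hτ.quadForm_le_one_iff ha x ht0).2 ht.le))

theorem newtonianPotential_ellipsoid (hN : 3 ≤ N) (ha : ∀ i, 0 < a i)
    {τ : EuclideanSpace ℝ (Fin N) → ℝ} (hτ : IsConfocalParameter a τ)
    (x : EuclideanSpace ℝ (Fin N)) :
    newtonianPotential (ellipsoid a 0) ((ellipsoid a 0).indicator 1) x =
      1 / 4 * ∫ t in Ioi (τ x), potentialIntegrand a x t := by
  have hNr : (3 : ℝ) ≤ N := by exact_mod_cast hN
  have hΓ := Real.Gamma_pos_of_pos (show 0 < (N : ℝ) / 2 - 1 by linarith)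
  have hI : ∫ y in ellipsoid a 0, (ellipsoid a 0).indicator 1 y / ‖x - y‖ ^ (N - 2) =
      ∫ y in ellipsoid a 0, 1 / ‖x - y‖ ^ (N - 2) :=
    setIntegral_congr_fun (isClosed_ellipsoid le_rfl).measurableSet fun y hy => by
      simp [indicator_of_mem hy]
  have key := congrArg ENNReal.toReal (lintegral_riesz_ellipsoid hN ha x)
  rw [ENNReal.toReal_mul, ENNReal.toReal_mul, ENNReal.toReal_ofReal hΓ.le,
    ENNReal.toReal_ofReal (by positivity), toReal_setLIntegral_gammaWeight hN ha hτ,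
    ← integral_eq_lintegral_of_nonneg_ae (.of_forall fun y => by positivity)
      (integrableOn_riesz_ellipsoid hN ha x).1] at key
  rw [newtonianPotential, hI, sphereArea_normalization hN, div_mul_eq_mul_div, key]
  have := Real.pi_pos
  field_simp

end EllipsoidPotential

theorem mainTheorem1 (N : ℕ) (hN : 3 ≤ N) (a : Fin N → ℝ) (ha : ∀ i, 0 < a i) :
    -- the function `τ` is well defined
    (∃! τ : EuclideanSpace ℝ (Fin N) → ℝ, EllipsoidPotential.IsConfocalParameter a τ) ∧
    -- both integrals converge, and the formula holds at every point
    (∀ τ : EuclideanSpace ℝ (Fin N) → ℝ, EllipsoidPotential.IsConfocalParameter a τ →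
      ∀ x : EuclideanSpace ℝ (Fin N),
        MeasureTheory.IntegrableOn (fun y => 1 / ‖x - y‖ ^ (N - 2))
          (EllipsoidPotential.ellipsoid a 0) ∧
        MeasureTheory.IntegrableOn (EllipsoidPotential.potentialIntegrand a x)
          (Set.Ioi (τ x)) ∧
        EllipsoidPotential.newtonianPotential (EllipsoidPotential.ellipsoid a 0)
            ((EllipsoidPotential.ellipsoid a 0).indicator 1) x =
          1 / 4 * ∫ t in Set.Ioi (τ x), EllipsoidPotential.potentialIntegrand a x t) ∧
    -- in particular the interior potential is a quadratic polynomial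
    (∀ x ∈ closure (EllipsoidPotential.ellipsoid a 0),
      EllipsoidPotential.newtonianPotential (EllipsoidPotential.ellipsoid a 0)
          ((EllipsoidPotential.ellipsoid a 0).indicator 1) x =
        1 / 4 * (∫ t in Set.Ioi (0 : ℝ), EllipsoidPotential.gammaWeight a t) -
          ∑ i, (1 / 4 * ∫ t in Set.Ioi (0 : ℝ),
            EllipsoidPotential.gammaWeight a t / (a i ^ 2 + t)) * x i ^ 2) := by

  refine ⟨EllipsoidPotential.existsUnique_isConfocalParameter ha, fun τ hτ x =>
    ⟨EllipsoidPotential.integrableOn_riesz_ellipsoid hN ha x,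
      (EllipsoidPotential.integrableOn_potentialIntegrand hN ha x).mono_set
        (Set.Ioi_subset_Ioi (hτ.1 x)),
      EllipsoidPotential.newtonianPotential_ellipsoid hN ha hτ x⟩, fun x hx => ?_⟩
  -- The interior formula does not mention `τ`; the exact formula for the existing one is used at
  -- its value 0.
  obtain ⟨τ, hτ, -⟩ := EllipsoidPotential.existsUnique_isConfocalParameter ha
  rw [EllipsoidPotential.newtonianPotential_ellipsoid hN ha hτ x, hτ.2.1 x hx,
    EllipsoidPotential.setIntegral_potentialIntegrand hN ha x, mul_sub, Finset.mul_sum]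
  congr 1
  exact Finset.sum_congr rfl fun i _ => by ring
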